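/- Let $F$ be a field and let $G$ be a group with identity $1$, written multiplicatively. Let $\mathrm{UT}=\bigcup_{n\ge 1}\mathrm{UT}_n(F)$ be the direct limit of the algebras of upper triangular $n\times n$ matrices, where $\mathrm{UT}_n(F)\subseteq\mathrm{UT}_{n+1}(F)$ by bordering with a zero row and a zero column; thus $\mathrm{UT}$ is the non-unital associative algebra with basis the matrix units $e_{ij}$, $1\le i\le j$. A $G$-grading $\Gamma$ on $\mathrm{UT}$ is a family of subspaces $(A_g)_{g\in G}$ with $\mathrm{UT}=\bigoplus_{g\in G}A_g$ and $A_gA_h\subseteq A_{gh}$ for all $g,h\in G$. Two $G$-gradings $(A_g)$ and $(A'_g)$ are isomorphic, written $\Gamma\cong\Gamma'$, if there is an algebra automorphism $f$ of $\mathrm{UT}$ with $f(A_g)\subseteq A'_g$ for all $g\in G$. For a map $\gamma\colon\mathbb N=\{1,2,\dots\}\to G$, let $\Gamma(\gamma)$ be the elementary grading in which $e_{ij}$ $(i\le j)$ is homogeneous of degree $\gamma(i)^{-1}\gamma(j)$, that is, $A_g=\mathrm{span}\{e_{ij}\mid i\le j,\ \gamma(i)^{-1}\gamma(j)=g\}$.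 Then every $G$-grading on $\mathrm{UT}$ is isomorphic to an elementary grading $\Gamma(\gamma)$ for some map $\gamma\colon\mathbb N\to G$ normalized by $\gamma(1)=1$. Moreover, for maps $\gamma,\gamma'\colon\mathbb N\to G$ with $\gamma(1)=\gamma'(1)=1$, one has $\Gamma(\gamma)\cong\Gamma(\gamma')$ if and only if $\gamma=\gamma'$. -/

import Mathlib

noncomputable section

/-- A `G`-grading on a (not necessarily unital) associative algebra `A` over a field `F`: a family
of subspaces `A_g`, `g ∈ G`, such that `A = ⨁ A_g` and `A_g A_h ⊆ A_{gh}`. -/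
structure GroupGrading (F : Type*) [Field F] (G : Type*) [Group G]
    (A : Type*) [NonUnitalRing A] [Module F A] where
  component : G → Submodule F A
  isInternal : letI := Classical.decEq G; DirectSum.IsInternal component
  mul_mem : ∀ {g h : G} {a b : A}, a ∈ component g → b ∈ component h → a * b ∈ component (g * h)

/-- Two `G`-gradings on the same algebra are isomorphic if there is an algebra automorphism `f`
(bijective, linear, multiplicative) with `f (A_g) ⊆ A'_g` for all `g`. -/
def GroupGrading.Isomorphic {F : Type*} [Field F] {G : Type*} [Group G]
    {A : Type*} [NonUnitalRing A] [Module F A] (Γ Γ' : GroupGrading F G A) : Prop :=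
  ∃ f : A →ₙₐ[F] A, Function.Bijective f ∧
    ∀ g : G, ∀ a ∈ Γ.component g, f a ∈ Γ'.component g

/-- The algebra `UT_n(F)` of upper triangular `n × n` matrices, realised as the upper triangular
`ℕ × ℕ` matrices which vanish outside the upper left `n × n` corner (rows and columns are indexed by
`0, 1, …, n - 1`). An upper triangular `ℕ × ℕ` matrix `a` is an element of the incidence algebra of
`(ℕ, ≤)`: `a i j = 0` unless `i ≤ j`, with entrywise linear structure and the matrix product
`(a * b) i k = ∑_{i ≤ j ≤ k} a i j * b j k`. For `n ≤ m`, the inclusion `UT_n(F) ⊆ UT_m(F)` is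
bordering by zero rows and columns. -/
def UTn (F : Type*) [Field F] (n : ℕ) : NonUnitalSubalgebra F (IncidenceAlgebra F ℕ) where
  carrier := {a | ∀ i j, a i j ≠ 0 → j < n}
  add_mem' := by
    intro a b ha hb i j h
    by_cases h1 : a i j = 0
    · exact hb i j fun h2 => h (by rw [IncidenceAlgebra.add_apply, h1, h2, add_zero])
    · exact ha i j h1
  zero_mem' := fun i j h => absurd (IncidenceAlgebra.zero_apply i j) h
  mul_mem' := by
    intro a b _ hb i k h
    rw [IncidenceAlgebra.mul_apply] at h
    obtain ⟨j, -, hj⟩ := Finset.exists_ne_zero_of_sum_ne_zero h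
    exact hb j k (right_ne_zero_of_mul hj)
  smul_mem' := by
    intro c a ha i j h
    exact ha i j fun h2 => h (by rw [IncidenceAlgebra.constSMul_apply, h2, smul_zero])

theorem UTn_mono (F : Type*) [Field F] {n m : ℕ} (h : n ≤ m) : UTn F n ≤ UTn F m :=
  fun _ ha i j hij => (ha i j hij).trans_le h

/-- The union `⋃ₙ UT_n(F)`, the direct limit of the algebras `UT_n(F)`,
realised as the upper triangular `ℕ × ℕ` matrices with finitely many nonzero entries. -/
def UTsub (F : Type*) [Field F] : NonUnitalSubalgebra F (IncidenceAlgebra F ℕ) where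
  carrier := ⋃ n : ℕ, (UTn F n : Set (IncidenceAlgebra F ℕ))
  add_mem' := by
    intro a b hs ht
    simp only [Set.mem_iUnion, SetLike.mem_coe] at hs ht ⊢
    obtain ⟨n, hn⟩ := hs
    obtain ⟨m, hm⟩ := ht
    exact ⟨max n m, add_mem (UTn_mono F (le_max_left n m) hn) (UTn_mono F (le_max_right n m) hm)⟩
  zero_mem' := Set.mem_iUnion.2 ⟨0, zero_mem (UTn F 0)⟩
  mul_mem' := by
    intro a b hs ht
    simp only [Set.mem_iUnion, SetLike.mem_coe] at hs ht ⊢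
    obtain ⟨n, hn⟩ := hs
    obtain ⟨m, hm⟩ := ht
    exact ⟨max n m, mul_mem (UTn_mono F (le_max_left n m) hn) (UTn_mono F (le_max_right n m) hm)⟩
  smul_mem' := by
    intro c t ht
    simp only [Set.mem_iUnion, SetLike.mem_coe] at ht ⊢
    obtain ⟨n, hn⟩ := ht
    exact ⟨n, SMulMemClass.smul_mem c hn⟩

/-- The (non-unital, associative) algebra `UT = ⋃ₙ UT_n(F)`. -/
def UT (F : Type*) [Field F] : Type _ := UTsub F

instance (F : Type*) [Field F] : NonUnitalRing (UT F) :=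
  inferInstanceAs (NonUnitalRing (UTsub F))

instance (F : Type*) [Field F] : Module F (UT F) :=
  inferInstanceAs (Module F (UTsub F))

namespace InfUT

variable {F : Type*} [Field F]

/-- The matrix unit `e_{ij}`, `i ≤ j`, as an element of `UT`: its `(i, j)` entry is `1` and all its
other entries are `0`. -/
def unit (F : Type*) [Field F] (i j : ℕ) (h : i ≤ j) : UT F where
  val :=
    { toFun := fun k l => if k = i ∧ l = j then 1 else 0
      eq_zero_of_not_le' := fun _ _ hkl => if_neg fun ⟨hk, hl⟩ => hkl (hk ▸ hl ▸ h) }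
  property := Set.mem_iUnion.2 ⟨j + 1, fun k l hkl => by
    have h1 : (if k = i ∧ l = j then (1 : F) else 0) ≠ 0 := hkl
    have h2 : k = i ∧ l = j := by
      by_contra hc
      exact h1 (if_neg hc)
    exact h2.2 ▸ l.lt_succ_self⟩

/-- The `(i, j)` entry, as a linear functional on `UT`. -/
def entry (F : Type*) [Field F] (i j : ℕ) : UT F →ₗ[F] F where
  toFun a := a.val i j
  map_add' _ _ := rfl
  map_smul' _ _ := rfl

theorem entry_unit (i j : ℕ) (h : i ≤ j) (k l : ℕ) :
    entry F k l (unit F i j h) = if k = i ∧ l = j then 1 else 0 := rfl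

theorem entry_mul (a b : UT F) (i k : ℕ) :
    entry F i k (a * b) = ∑ j ∈ Finset.Icc i k, entry F i j a * entry F j k b := rfl

theorem ext_entry {a b : UT F} (h : ∀ i j, entry F i j a = entry F i j b) : a = b :=
  Subtype.ext (IncidenceAlgebra.ext fun i j _ => h i j)

variable {G : Type*} [Group G]

instance : IsScalarTower F (UT F) (UT F) where
  smul_assoc c a b := ext_entry fun i j => by
    simp only [smul_eq_mul, map_smul, entry_mul, Finset.mul_sum, mul_assoc]

instance : SMulCommClass F (UT F) (UT F) where
  smul_comm c a b := ext_entry fun i j => by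
    simp only [smul_eq_mul, map_smul, entry_mul, Finset.mul_sum, mul_left_comm]

/-- The homogeneous component of degree `g` of `Γ(γ)`: the span of the matrix units `e_{ij}`,
`i ≤ j`, with `γ(i)⁻¹ γ(j) = g`. -/
def elementaryComponent (F : Type*) [Field F] (γ : ℕ → G) (g : G) : Submodule F (UT F) :=
  Submodule.span F {a | ∃ (i j : ℕ) (h : i ≤ j), (γ i)⁻¹ * γ j = g ∧ a = unit F i j h}

theorem exists_eq_sum (a : UT F) : ∃ n : ℕ, a = ∑ i ∈ Finset.range n, ∑ j ∈ Finset.range n,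
    if h : i ≤ j then entry F i j a • unit F i j h else 0 := by
  obtain ⟨n, hn⟩ := Set.mem_iUnion.1 a.2
  refine ⟨n, ext_entry fun k l => ?_⟩
  have hφ : ∀ i j, entry F k l (if h : i ≤ j then entry F i j a • unit F i j h else 0)
      = if k = i then if l = j then entry F k l a else 0 else 0 := by
    intro i j
    by_cases h : i ≤ j
    · rw [dif_pos h, map_smul, entry_unit, smul_eq_mul]
      by_cases h1 : k = i
      · by_cases h2 : l = j
        · subst h1 h2; simp
        · simp [h2]
      · simp [h1]
    · rw [dif_neg h, map_zero]
      by_cases h1 : k = i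
      · by_cases h2 : l = j
        · subst h1 h2
          rw [if_pos rfl, if_pos rfl]
          exact (IncidenceAlgebra.apply_eq_zero_of_not_le h a.val).symm
        · simp [h2]
      · simp [h1]
  simp only [map_sum, hφ]
  by_cases h0 : entry F k l a = 0
  · simp [h0]
  · have hl : l < n := hn k l h0
    have hk : k < n := (IncidenceAlgebra.le_of_ne_zero h0).trans_lt hl
    simp [hk, hl]

theorem mem_elementaryComponent_iff {γ : ℕ → G} {g : G} {a : UT F} :
    a ∈ elementaryComponent F γ g ↔ ∀ i j, entry F i j a ≠ 0 → (γ i)⁻¹ * γ j = g := by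
  constructor
  · intro ha i j hij
    by_contra hg
    refine hij ?_
    have hle : elementaryComponent F γ g ≤ LinearMap.ker (entry F i j) := by
      refine Submodule.span_le.2 ?_
      rintro _ ⟨k, l, h, hkl, rfl⟩
      refine (entry_unit k l h i j).trans (if_neg ?_)
      rintro ⟨rfl, rfl⟩
      exact hg hkl
    exact hle ha
  · intro ha
    obtain ⟨n, hn⟩ := exists_eq_sum a
    rw [hn]
    refine Submodule.sum_mem _ fun i _ => Submodule.sum_mem _ fun j _ => ?_
    split_ifs with h
    · by_cases h0 : entry F i j a = 0
      · rw [h0, zero_smul]; exact Submodule.zero_mem _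
      · exact Submodule.smul_mem _ _ (Submodule.subset_span ⟨i, j, h, ha i j h0, rfl⟩)
    · exact Submodule.zero_mem _

theorem elementaryComponent_isInternal (γ : ℕ → G) [DecidableEq G] :
    DirectSum.IsInternal (elementaryComponent F γ) := by
  refine DirectSum.isInternal_submodule_of_iSupIndep_of_iSup_eq_top ?_ ?_
  · intro g
    rw [Submodule.disjoint_def]
    intro a ha hb
    refine ext_entry fun i j => ?_
    rw [map_zero]
    by_contra h0
    have hle : (⨆ (k) (_ : k ≠ g), elementaryComponent F γ k) ≤ LinearMap.ker (entry F i j) := by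
      refine iSup₂_le fun k hk x hx => ?_
      by_contra h1
      exact hk ((mem_elementaryComponent_iff.1 hx i j h1).symm.trans
        (mem_elementaryComponent_iff.1 ha i j h0))
    exact h0 (hle hb)
  · rw [eq_top_iff]
    intro a _
    obtain ⟨n, hn⟩ := exists_eq_sum a
    rw [hn]
    refine Submodule.sum_mem _ fun i _ => Submodule.sum_mem _ fun j _ => ?_
    split_ifs with h
    · refine Submodule.smul_mem _ _ (Submodule.mem_iSup_of_mem ((γ i)⁻¹ * γ j) ?_)
      exact Submodule.subset_span ⟨i, j, h, rfl, rfl⟩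
    · exact Submodule.zero_mem _

end InfUT

open InfUT in
/-- The elementary grading `Γ(γ)` on `UT` defined by a map `γ : ℕ → G`: each matrix unit `e_{ij}`,
`i ≤ j`, is homogeneous of degree `γ(i)⁻¹ γ(j)`. -/
def elementaryGrading (F : Type*) [Field F] {G : Type*} [Group G] (γ : ℕ → G) :
    GroupGrading F G (UT F) where
  component := elementaryComponent F γ
  isInternal := by
    let _ := Classical.decEq G
    exact elementaryComponent_isInternal γ
  mul_mem := by
    intro g h a b ha hb
    rw [mem_elementaryComponent_iff] at ha hb ⊢
    intro i k hik
    rw [entry_mul] at hik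
    obtain ⟨j, -, hj⟩ := Finset.exists_ne_zero_of_sum_ne_zero hik
    rw [← ha i j (left_ne_zero_of_mul hj), ← hb j k (right_ne_zero_of_mul hj)]
    group

end

/-! ### Entries, products and primitive idempotents. -/

namespace InfUT

variable {F : Type*} [Field F]

/-! Existence amounts to replacing the idempotents `e_ii` by orthogonal idempotents `η i` of degree
1, where `η i` has a single nonzero diagonal entry, the `i`-th, and finite sums of the `η i` act as
identities on every `UT_n`. Each space `η i * UT * η j` with `i ≤ j` is then a line spanned by `η i
* e_ij * η j`. Since it is stable under the homogeneous projections, its generator is homogeneous.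
These generators multiply like matrix units, so their degrees have the form `(γ i)⁻¹ * γ j`, and
taking coordinates along them (`IsFamily.coord`) is the required automorphism.

The family comes from two facts. The degree 1 component contains an idempotent acting as an identity
on any given `UT_n` (`exists_idem_isLocalUnit`): project a large identity matrix to degree 1 and
correct it by polynomials. An idempotent `e` of degree 1 whose first nonzero diagonal position is
`i` dominates a primitive one of degree 1 (`exists_isPrimitiveAt`): the element `r = e * e_ii * e`
satisfies `x * r = x_ii • r` on `e * UT * e`, which forces its degree 1 part to be a multiple of
such an idempotent, in every characteristic and for every group.

For uniqueness, an automorphism sends `e_ii` to an idempotent primitive at the same `i`, because the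
order on the indices is recovered from the products. Hence the image of `e_0j` has a nonzero `(0,
j)` entry, and that entry reveals `γ j`. -/

theorem entry_of_lt {i j : ℕ} (h : j < i) (a : UT F) : entry F i j a = 0 :=
  IncidenceAlgebra.apply_eq_zero_of_not_le (not_le.2 h) a.val

theorem entry_mul_of_le (a b : UT F) (i : ℕ) {k n : ℕ} (h : k ≤ n) :
    entry F i k (a * b) = ∑ j ∈ Finset.Icc i n, entry F i j a * entry F j k b := by
  rw [entry_mul]
  refine Finset.sum_subset (Finset.Icc_subset_Icc_right h) fun j hj hj' => ?_
  rw [entry_of_lt (by simp at hj hj'; omega) b, mul_zero]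

theorem entry_diag_mul (a b : UT F) (i : ℕ) :
    entry F i i (a * b) = entry F i i a * entry F i i b := by
  rw [entry_mul, Finset.Icc_self, Finset.sum_singleton]

theorem entry_mul_unit (a : UT F) {i j : ℕ} (h : i ≤ j) (k l : ℕ) :
    entry F k l (a * unit F i j h) = if l = j then entry F k i a else 0 := by
  rw [entry_mul]
  split_ifs with hl
  · subst hl
    rcases lt_or_ge i k with hk | hk
    · rw [entry_of_lt hk]
      refine Finset.sum_eq_zero fun m hm => ?_
      rw [entry_unit, if_neg (by simp at hm; omega), mul_zero]
    · rw [Finset.sum_eq_single i]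
      · simp [entry_unit]
      · intro m _ hm
        simp [entry_unit, hm]
      · intro hi
        exact absurd (Finset.mem_Icc.2 ⟨hk, h⟩) hi
  · refine Finset.sum_eq_zero fun m _ => ?_
    simp [entry_unit, hl]

theorem entry_unit_mul (a : UT F) {i j : ℕ} (h : i ≤ j) (k l : ℕ) :
    entry F k l (unit F i j h * a) = if k = i then entry F j l a else 0 := by
  rw [entry_mul]
  split_ifs with hl
  · subst hl
    rcases lt_or_ge l j with hk | hk
    · rw [entry_of_lt hk]
      refine Finset.sum_eq_zero fun m hm => ?_
      rw [entry_unit, if_neg (by simp at hm; omega), zero_mul]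
    · rw [Finset.sum_eq_single j]
      · simp [entry_unit]
      · intro m _ hm
        simp [entry_unit, hm]
      · intro hi
        exact absurd (Finset.mem_Icc.2 ⟨h, hk⟩) hi
  · refine Finset.sum_eq_zero fun m _ => ?_
    simp [entry_unit, hl]

theorem unit_mul_mul_unit (a : UT F) {i j k l : ℕ} (hij : i ≤ j) (hjk : j ≤ k) (hkl : k ≤ l) :
    unit F i j hij * a * unit F k l hkl
      = entry F j k a • unit F i l (hij.trans (hjk.trans hkl)) := by
  refine ext_entry fun m n => ?_
  rw [entry_mul_unit, map_smul, entry_unit, entry_unit_mul]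
  by_cases hm : m = i <;> by_cases hn : n = l <;> simp [hm, hn]

theorem unit_mul_mul_unit_of_entry_eq_zero (a : UT F) {i j k l : ℕ} (hij : i ≤ j) (hkl : k ≤ l)
    (h : entry F j k a = 0) : unit F i j hij * a * unit F k l hkl = 0 := by
  refine ext_entry fun m n => ?_
  rw [entry_mul_unit, entry_unit_mul, h, map_zero, ite_self, ite_self]

/-- Truncated to indices up to `l`, the idempotent `e` has rank at most one, so column `l` of `x`,
being in its image, is a multiple of column `i` of `e`. The proof is an induction on rows from the
bottom up. -/
theorem entry_eq_of_mul_eq {e x : UT F} (he : e * e = e) (hx : e * x = x) {i l : ℕ}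
    (hi : entry F i i e = 1) (h0 : ∀ k, k ≤ l → k ≠ i → entry F k k e = 0) (k : ℕ) :
    entry F k l x = entry F k i e * entry F i l x := by
  rcases lt_or_ge l i with hli | hil
  · rw [entry_of_lt hli, mul_zero]
    suffices H : ∀ n k, l + 1 ≤ k + n → entry F k l x = 0 from H (l + 1) k (by omega)
    intro n
    induction n with
    | zero => exact fun k hk => entry_of_lt (by omega) x
    | succ n ih =>
      intro k hk
      rcases lt_or_ge l k with hlk | hkl
      · exact entry_of_lt hlk x
      rw [← hx, entry_mul]
      refine Finset.sum_eq_zero fun m hm => ?_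
      obtain ⟨h1, h2⟩ := Finset.mem_Icc.1 hm
      rcases h1.eq_or_lt with rfl | h1
      · rw [h0 _ hkl (by omega), zero_mul]
      · rw [ih m (by omega), mul_zero]
  · suffices H : ∀ n k, l + 1 ≤ k + n → entry F k l x = entry F k i e * entry F i l x from
      H (l + 1) k (by omega)
    intro n
    induction n with
    | zero =>
      intro k hk
      rw [entry_of_lt (by omega) x, entry_of_lt (by omega) e, zero_mul]
    | succ n ih =>
      intro k hk
      rcases lt_or_ge l k with hlk | hkl
      · rw [entry_of_lt (by omega) x, entry_of_lt (by omega) e, zero_mul]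
      by_cases hki : k = i
      · rw [hki, hi, one_mul]
      -- Both sides are expanded by `e * x = x` and `e * e = e` over the same range. The diagonal
      -- terms vanish and the rows below `k` are covered by induction.
      conv_lhs => rw [← hx, entry_mul]
      conv_rhs => rw [← he, entry_mul_of_le e e k hil, Finset.sum_mul]
      refine Finset.sum_congr rfl fun m hm => ?_
      obtain ⟨h1, h2⟩ := Finset.mem_Icc.1 hm
      rcases h1.eq_or_lt with rfl | h1
      · rw [h0 _ hkl hki, zero_mul, zero_mul, zero_mul]
      · rw [ih m (by omega), mul_assoc]

/-- A primitive idempotent of `UT`: its only nonzero diagonal entry is the `i`-th. -/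
structure IsPrimitiveAt (i : ℕ) (e : UT F) : Prop where
  idem : e * e = e
  diag : ∀ k, entry F k k e = if k = i then 1 else 0

namespace IsPrimitiveAt

variable {i j : ℕ} {e e' : UT F}

theorem diag_self (h : IsPrimitiveAt i e) : entry F i i e = 1 := by
  rw [h.diag, if_pos rfl]

theorem mul_unit_mul (h : IsPrimitiveAt i e) : e * unit F i i le_rfl * e = e := by
  refine ext_entry fun k l => ?_
  have := entry_eq_of_mul_eq h.idem h.idem h.diag_self
    (fun k (_ : k ≤ l) hk => by rw [h.diag, if_neg hk]) k
  rw [this, mul_assoc, entry_mul_of_le _ _ k (le_max_left l i)]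
  rcases lt_or_ge i k with hk | hk
  · rw [entry_of_lt hk, zero_mul]
    refine Finset.sum_eq_zero fun m hm => ?_
    rw [entry_unit_mul, if_neg (by simp at hm; omega), mul_zero]
  · rw [Finset.sum_eq_single i]
    · rw [entry_unit_mul, if_pos rfl]
    · intro m _ hm
      rw [entry_unit_mul, if_neg hm, mul_zero]
    · intro hi
      exact absurd (Finset.mem_Icc.2 ⟨hk, le_max_right _ _⟩) hi

/-- Inserting `e = e * e_ii * e` and `e' = e' * e_jj * e'` around `x` shows that `x` depends only on
its `(i, j)` entry: the space `e * UT * e'` is at most a line. -/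
theorem eq_zero_of_entry (h : IsPrimitiveAt i e) (h' : IsPrimitiveAt j e') {x : UT F}
    (hx : e * x = x) (hx' : x * e' = x) (h0 : entry F i j x = 0) : x = 0 := by
  have : e * (unit F i i le_rfl * x * unit F j j le_rfl) * e' = x := by
    calc _ = e * unit F i i le_rfl * x * (unit F j j le_rfl * e') := by simp only [mul_assoc]
      _ = e * unit F i i le_rfl * (e * (x * e')) * (unit F j j le_rfl * e') := by rw [hx', hx]
      _ = (e * unit F i i le_rfl * e) * x * (e' * unit F j j le_rfl * e') := by
        simp only [mul_assoc]
      _ = x := by rw [h.mul_unit_mul, h'.mul_unit_mul, hx, hx']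
  rw [← this, unit_mul_mul_unit_of_entry_eq_zero _ _ _ h0, mul_zero, zero_mul]

theorem le_of_ne_zero (h : IsPrimitiveAt i e) (h' : IsPrimitiveAt j e') {x : UT F}
    (hx : e * x = x) (hx' : x * e' = x) (h0 : x ≠ 0) : i ≤ j := by
  by_contra hij
  exact h0 (h.eq_zero_of_entry h' hx hx' (entry_of_lt (not_le.1 hij) x))

end IsPrimitiveAt

theorem entry_diag_of_idem {e : UT F} (he : e * e = e) (i : ℕ) :
    entry F i i e = 0 ∨ entry F i i e = 1 := by
  have h := entry_diag_mul e e i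
  rw [he] at h
  by_cases h0 : entry F i i e = 0
  · exact Or.inl h0
  · exact Or.inr (mul_left_cancel₀ h0 (by rw [← h, mul_one]))

/-- Squaring pushes the nonzero entries of a strictly upper triangular matrix further from the
diagonal. -/
theorem eq_zero_of_idem {e : UT F} (he : e * e = e) (h0 : ∀ i, entry F i i e = 0) : e = 0 := by
  have H : ∀ n i j, j < i + n → entry F i j e = 0 := by
    intro n
    induction n with
    | zero => exact fun i j h => entry_of_lt (by omega) e
    | succ n ih =>
      intro i j h
      rw [← he, entry_mul]
      refine Finset.sum_eq_zero fun m hm => ?_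
      obtain ⟨h1, h2⟩ := Finset.mem_Icc.1 hm
      rcases h1.eq_or_lt with rfl | h1
      · rw [h0, zero_mul]
      · rw [ih m j (by omega), mul_zero]
  exact ext_entry fun i j => H (j + 1) i j (by omega)

theorem exists_support (a : UT F) : ∃ n, ∀ i j, n ≤ j → entry F i j a = 0 := by
  obtain ⟨n, hn⟩ := Set.mem_iUnion.1 a.2
  refine ⟨n, fun i j hj => ?_⟩
  by_contra h
  exact absurd (hn i j h) (not_lt.2 hj)

/-- The identity matrix of `UT_n`. -/
def corner (F : Type*) [Field F] (n : ℕ) : UT F := ∑ i ∈ Finset.range n, unit F i i le_rfl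

theorem corner_mul {n : ℕ} {a : UT F} (h : ∀ i j, n ≤ j → entry F i j a = 0) :
    corner F n * a = a := by
  refine ext_entry fun k l => ?_
  simp only [corner, Finset.sum_mul, map_sum, entry_unit_mul]
  rw [Finset.sum_ite_eq]
  split_ifs with hk
  · rfl
  · rw [Finset.mem_range, not_lt] at hk
    rcases lt_or_ge l k with h1 | h1
    · exact (entry_of_lt h1 a).symm
    · exact (h k l (by omega)).symm

theorem mul_corner {n : ℕ} {a : UT F} (h : ∀ i j, n ≤ j → entry F i j a = 0) :
    a * corner F n = a := by
  refine ext_entry fun k l => ?_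
  simp only [corner, Finset.mul_sum, map_sum, entry_mul_unit]
  rw [Finset.sum_ite_eq]
  split_ifs with hk
  · rfl
  · rw [Finset.mem_range, not_lt] at hk
    exact (h k l hk).symm

theorem exists_corner (a : UT F) : ∃ n, ∀ m, n ≤ m → corner F m * a = a ∧ a * corner F m = a := by
  obtain ⟨n, hn⟩ := exists_support a
  have := fun m (hm : n ≤ m) i j (hj : m ≤ j) => hn i j (hm.trans hj)
  exact ⟨n, fun m hm => ⟨corner_mul (this m hm), mul_corner (this m hm)⟩⟩

theorem exists_corner_finset {ι : Type*} (s : Finset ι) (a : ι → UT F) :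
    ∃ n, ∀ m, n ≤ m → ∀ i ∈ s, corner F m * a i = a i ∧ a i * corner F m = a i := by
  choose n hn using fun i => exists_corner (a i)
  exact ⟨s.sup n, fun m hm i hi => hn i m ((Finset.le_sup hi).trans hm)⟩

end InfUT

/-! ### Homogeneous projections of a graded algebra. -/

namespace GroupGrading

variable {F : Type*} [Field F] {G : Type*} [Group G] {A : Type*} [NonUnitalRing A] [Module F A]

/-- The decomposition of elements of `A` into homogeneous components. -/
noncomputable def decompose (Γ : GroupGrading F G A) : A ≃ₗ[F] DirectSum G fun g => Γ.component g :=
  letI := Classical.decEq G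
  (LinearEquiv.ofBijective (DirectSum.coeLinearMap Γ.component) Γ.isInternal).symm

/-- The projection of `A` onto its homogeneous component of degree `g`. -/
noncomputable def proj (Γ : GroupGrading F G A) (g : G) : A →ₗ[F] A :=
  (Γ.component g).subtype ∘ₗ DirectSum.component F G (fun i => Γ.component i) g ∘ₗ
    Γ.decompose.toLinearMap

variable (Γ : GroupGrading F G A)

theorem decompose_symm_apply (x : DirectSum G fun g => Γ.component g) :
    letI := Classical.decEq G
    Γ.decompose.symm x = DirectSum.coeLinearMap Γ.component x := rfl

theorem proj_mem (g : G) (a : A) : Γ.proj g a ∈ Γ.component g :=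
  Subtype.prop _

theorem exists_finset_sum_proj (a : A) :
    ∃ s : Finset G, (∀ g ∉ s, Γ.proj g a = 0) ∧ ∑ g ∈ s, Γ.proj g a = a := by
  classical
  have hp : ∀ g, Γ.proj g a = (Γ.decompose a g : A) := fun g => rfl
  refine ⟨DFinsupp.support (Γ.decompose a), fun g hg => ?_, ?_⟩
  · rw [hp, DFinsupp.notMem_support_iff.1 hg]; rfl
  · conv_rhs => rw [← Γ.decompose.symm_apply_apply a]
    rw [decompose_symm_apply, DirectSum.coeLinearMap_eq_dfinsuppSum, DFinsupp.sum]
    simp only [hp]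

theorem decompose_of_mem {g : G} {a : A} (h : a ∈ Γ.component g) :
    letI := Classical.decEq G
    Γ.decompose a = DirectSum.lof F G (fun i => Γ.component i) g ⟨a, h⟩ := by
  let _ := Classical.decEq G
  rw [← LinearEquiv.eq_symm_apply, decompose_symm_apply, DirectSum.coeLinearMap_lof]

theorem proj_of_mem {g : G} {a : A} (h : a ∈ Γ.component g) : Γ.proj g a = a := by
  have h2 : Γ.proj g a =
      (DirectSum.component F G (fun i => Γ.component i) g (Γ.decompose a) : A) := rfl
  rw [h2, Γ.decompose_of_mem h, DirectSum.component.lof_self]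

theorem proj_of_mem_of_ne {g k : G} {a : A} (h : a ∈ Γ.component g) (hk : k ≠ g) :
    Γ.proj k a = 0 := by
  have h2 : Γ.proj k a =
      (DirectSum.component F G (fun i => Γ.component i) k (Γ.decompose a) : A) := rfl
  rw [h2, Γ.decompose_of_mem h, DirectSum.component.of, dif_neg hk.symm]
  rfl

theorem ext_proj {a b : A} (h : ∀ g, Γ.proj g a = Γ.proj g b) : a = b := by
  obtain ⟨s, -, hs⟩ := Γ.exists_finset_sum_proj (a - b)
  rw [← sub_eq_zero, ← hs]
  exact Finset.sum_eq_zero fun g _ => by rw [map_sub, h, sub_self]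

theorem exists_proj_ne_zero {a : A} (ha : a ≠ 0) : ∃ g, Γ.proj g a ≠ 0 := by
  by_contra! h
  exact ha (Γ.ext_proj fun g => by rw [h, map_zero])

theorem eq_of_mem_of_mem {g h : G} {a : A} (ha : a ≠ 0) (hg : a ∈ Γ.component g)
    (hh : a ∈ Γ.component h) : g = h := by
  by_contra hne
  exact ha (by rw [← Γ.proj_of_mem hg, Γ.proj_of_mem_of_ne hh hne])

theorem proj_mul_left {h : G} {a : A} (ha : a ∈ Γ.component h) (g : G) (x : A) :
    Γ.proj (h * g) (a * x) = a * Γ.proj g x := by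
  obtain ⟨s, h0, hs⟩ := Γ.exists_finset_sum_proj x
  conv_lhs => rw [← hs, Finset.mul_sum, map_sum]
  have hm := fun k => Γ.mul_mem ha (Γ.proj_mem k x)
  rw [Finset.sum_eq_single g, Γ.proj_of_mem (hm g)]
  · intro k _ hk
    exact Γ.proj_of_mem_of_ne (hm k) fun h => hk (mul_left_cancel h).symm
  · intro hg
    rw [h0 g hg, mul_zero, map_zero]

theorem proj_mul_right {h : G} {a : A} (ha : a ∈ Γ.component h) (g : G) (x : A) :
    Γ.proj (g * h) (x * a) = Γ.proj g x * a := by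
  obtain ⟨s, h0, hs⟩ := Γ.exists_finset_sum_proj x
  conv_lhs => rw [← hs, Finset.sum_mul, map_sum]
  have hm := fun k => Γ.mul_mem (Γ.proj_mem k x) ha
  rw [Finset.sum_eq_single g, Γ.proj_of_mem (hm g)]
  · intro k _ hk
    exact Γ.proj_of_mem_of_ne (hm k) fun h => hk (mul_right_cancel h).symm
  · intro hg
    rw [h0 g hg, zero_mul, map_zero]

theorem proj_mul_of_mem_one {a : A} (ha : a ∈ Γ.component 1) (g : G) (x : A) :
    Γ.proj g (a * x) = a * Γ.proj g x := by
  simpa using Γ.proj_mul_left ha g x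

theorem mul_proj_of_mem_one {a : A} (ha : a ∈ Γ.component 1) (g : G) (x : A) :
    Γ.proj g (x * a) = Γ.proj g x * a := by
  simpa using Γ.proj_mul_right ha g x

theorem mul_mem_one {a b : A} (ha : a ∈ Γ.component 1) (hb : b ∈ Γ.component 1) :
    a * b ∈ Γ.component 1 := by
  simpa using Γ.mul_mem ha hb

end GroupGrading

/-! ### Primitive idempotents of degree 1. -/

namespace InfUT

variable {F : Type*} [Field F] {G : Type*} [Group G]

/-- Position `i` is the first one in `e`, so only multiples of the `i`-th column of `e` can occur as
the `i`-th column of `x`. -/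
theorem mul_unit_of_idem {e x : UT F} (he : e * e = e) (hx : e * x = x) {i : ℕ}
    (hi : entry F i i e = 1) (h0 : ∀ k < i, entry F k k e = 0) :
    x * unit F i i le_rfl = entry F i i x • (e * unit F i i le_rfl) := by
  refine ext_entry fun k l => ?_
  rw [map_smul, entry_mul_unit, entry_mul_unit]
  split_ifs
  · rw [entry_eq_of_mul_eq he hx hi (fun k hk hk' => h0 k (by omega)) k, smul_eq_mul, mul_comm]
  · rw [smul_zero]

/-- A finitely supported function on a group which is invariant under left translation by the
elements of its support is nonzero at `1`, unless it vanishes. -/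
theorem apply_one_ne_zero_of_translation {φ : G → F} {s : Finset G} (hs : ∀ g ∉ s, φ g = 0)
    (hφ : ∀ h k, φ h ≠ 0 → φ (h * k) = φ k) {g : G} (hg : φ g ≠ 0) : φ 1 ≠ 0 := by
  have hpow : ∀ n : ℕ, ∀ k, φ (g ^ n * k) = φ k := by
    intro n
    induction n with
    | zero => intro k; rw [pow_zero, one_mul]
    | succ n ih => intro k; rw [pow_succ, mul_assoc, ih, hφ g k hg]
  -- All positive powers of `g` lie in the finite set `s`, so `g` has finite order and `1` is itself
  -- one of them.
  have hmem : ∀ n : ℕ, g ^ n * g ∈ s := fun n => by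
    by_contra h
    exact hg (by rw [← hpow n g, hs _ h])
  have hni : ¬ Function.Injective fun n : ℕ => (⟨g ^ n * g, hmem n⟩ : s) :=
    not_injective_infinite_finite _
  have hfin : IsOfFinOrder g := by
    by_contra h
    refine hni fun a b hab => ?_
    exact (injective_pow_iff_not_isOfFinOrder.2 h) (mul_right_cancel (Subtype.ext_iff.1 hab))
  obtain ⟨n, hn, hgn⟩ := hfin.exists_pow_eq_one
  obtain ⟨m, rfl⟩ : ∃ m, n = m + 1 := ⟨n - 1, by omega⟩
  have := hpow m g
  rw [← pow_succ, hgn] at this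
  rwa [this]

/-- If the `i`-th diagonal entry is the first nonzero one of an idempotent `e` of degree `1`, then
`e` dominates an idempotent of degree `1` which is primitive at `i`. -/
theorem exists_isPrimitiveAt (Γ : GroupGrading F G (UT F)) {e : UT F} (he1 : e ∈ Γ.component 1)
    (he : e * e = e) {i : ℕ} (hi : entry F i i e = 1) (h0 : ∀ k < i, entry F k k e = 0) :
    ∃ u ∈ Γ.component 1, e * u = u ∧ u * e = u ∧ IsPrimitiveAt i u := by
  set r : UT F := e * unit F i i le_rfl * e with hr
  have her : e * r = r := by rw [hr, ← mul_assoc, ← mul_assoc, he]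
  have hre : r * e = r := by rw [hr, mul_assoc, he]
  have hrr : ∀ x : UT F, e * x = x → x * e = x → x * r = entry F i i x • r := by
    intro x hx hx'
    rw [hr, ← mul_assoc, ← mul_assoc, hx', mul_unit_of_idem he hx hi h0, smul_mul_assoc]
  have hri : entry F i i r = 1 := by
    rw [hr, entry_diag_mul, entry_diag_mul, hi, entry_unit]; simp
  set ρ : G → UT F := fun g => Γ.proj g r with hρ
  have heρ : ∀ g, e * ρ g = ρ g := fun g => by
    rw [hρ]; simp only; rw [← Γ.proj_mul_of_mem_one he1, her]
  have hρe : ∀ g, ρ g * e = ρ g := fun g => by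
    rw [hρ]; simp only; rw [← Γ.mul_proj_of_mem_one he1, hre]
  -- This is the component of degree `h * k` of the relation `x * r = x_ii • r`.
  have hhom : ∀ {h} {x : UT F}, x ∈ Γ.component h → e * x = x → x * e = x → ∀ k,
      x * ρ k = entry F i i x • ρ (h * k) := by
    intro h x hxh hx hx' k
    rw [hρ]; simp only
    rw [← Γ.proj_mul_left hxh, hrr x hx hx', map_smul]
  set φ : G → F := fun g => entry F i i (ρ g) with hφ
  have hρρ : ∀ h k, ρ h * ρ k = φ h • ρ (h * k) := fun h k =>
    hhom (Γ.proj_mem h r) (heρ h) (hρe h) k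
  -- The `(i, i)` entry of `hρρ` reads `φ h * φ k = φ h * φ (h * k)`.
  have htr : ∀ h k, φ h ≠ 0 → φ (h * k) = φ k := by
    intro h k hh
    have := congrArg (entry F i i) (hρρ h k)
    rw [entry_diag_mul, map_smul, smul_eq_mul] at this
    exact (mul_left_cancel₀ hh this).symm
  obtain ⟨s, hs0, hs⟩ := Γ.exists_finset_sum_proj r
  have hc : φ 1 ≠ 0 := by
    obtain ⟨g, -, hg⟩ : ∃ g ∈ s, φ g ≠ 0 := by
      refine Finset.exists_ne_zero_of_sum_ne_zero ?_
      rw [hφ, ← map_sum, hs, hri]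
      exact one_ne_zero
    refine apply_one_ne_zero_of_translation (s := s) (fun g hg => ?_) htr hg
    rw [hφ]; simp only [hρ]
    rw [hs0 g hg, map_zero]
  set u : UT F := (φ 1)⁻¹ • ρ 1 with hu
  have hu1 : u ∈ Γ.component 1 := Submodule.smul_mem _ _ (Γ.proj_mem 1 r)
  have hρu : ρ 1 = φ 1 • u := by rw [hu, smul_smul, mul_inv_cancel₀ hc, one_smul]
  have heu : e * u = u := by rw [hu, mul_smul_comm, heρ]
  have hue : u * e = u := by rw [hu, smul_mul_assoc, hρe]
  have huu : u * u = u := by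
    conv_lhs => rw [hu]
    rw [smul_mul_assoc, mul_smul_comm, hρρ, mul_one, smul_smul (φ 1)⁻¹ (φ 1),
      inv_mul_cancel₀ hc, one_smul]
  have hui : entry F i i u = 1 := by
    rw [hu, map_smul, smul_eq_mul]
    exact inv_mul_cancel₀ hc
  refine ⟨u, hu1, heu, hue, huu, fun j => ?_⟩
  split_ifs with hji
  · rw [hji, hui]
  -- Positions before `i` vanish because `e * u = u`. A later position `j` with entry 1 is excluded
  -- by computing `r * y`, for `y = u * e_ij * u`, in two incompatible ways.
  rcases lt_or_gt_of_ne hji with hlt | hgt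
  · rw [← heu, entry_diag_mul, h0 j hlt, zero_mul]
  rcases entry_diag_of_idem huu j with huj | huj
  · exact huj
  exfalso
  -- `r * ρ k` does not depend on `k` in the support of `φ`
  have hrρ : ∀ k, φ k ≠ 0 → r * ρ k = r * ρ 1 := by
    intro k hk
    refine Γ.ext_proj fun m => ?_
    have h1 := Γ.proj_mul_right (Γ.proj_mem k r) (m * k⁻¹) r
    have h2 := Γ.proj_mul_right (Γ.proj_mem 1 r) m r
    rw [inv_mul_cancel_right] at h1
    rw [mul_one] at h2
    -- By `htr`, the support of `φ` is a subgroup on which `φ` is constant, and `k` belongs to it.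
    have h3 : φ (m * k⁻¹) = φ m := by
      by_cases h0 : φ (m * k⁻¹) = 0
      · by_contra hm
        rw [h0] at hm
        have h4 := htr k k⁻¹ hk
        rw [mul_inv_cancel] at h4
        rw [htr m k⁻¹ (Ne.symm hm), ← h4] at h0
        exact hc h0
      · have h4 := htr _ k h0
        have h5 := htr _ 1 h0
        have h6 := htr _ 1 hk
        rw [inv_mul_cancel_right] at h4
        rw [mul_one] at h5 h6
        rw [h5, h4, h6]
    rw [h1, h2]
    change ρ (m * k⁻¹) * ρ k = ρ m * ρ 1
    rw [hρρ, hρρ, inv_mul_cancel_right, mul_one, h3]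
  set y : UT F := u * unit F i j hgt.le * u with hy
  have huy : u * y = y := by rw [hy, ← mul_assoc, ← mul_assoc, huu]
  have hyu : y * u = y := by rw [hy, mul_assoc, huu]
  have hey : e * y = y := by rw [← huy, ← mul_assoc, heu]
  have hye : y * e = y := by rw [← hyu, mul_assoc, hue]
  have hyi : entry F i i y = 0 := by
    rw [hy, entry_diag_mul, entry_diag_mul, entry_unit, if_neg (by omega), mul_zero, zero_mul]
  have hyk : ∀ k, r * Γ.proj k y = entry F i i (Γ.proj k y) • (r * u) := by
    intro k
    set z := Γ.proj k y with hz
    have hzu : z * u = z := by rw [hz, ← Γ.mul_proj_of_mem_one hu1, hyu]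
    have hzρ : φ 1 • z = entry F i i z • ρ k := by
      have := hhom (Γ.proj_mem k y) (by rw [← Γ.proj_mul_of_mem_one he1, hey])
        (by rw [← Γ.mul_proj_of_mem_one he1, hye]) 1
      rw [mul_one, ← hz, hρu, mul_smul_comm, hzu] at this
      exact this
    by_cases hzi : entry F i i z = 0
    · rw [hzi, zero_smul, smul_eq_zero] at hzρ
      rw [hzρ.resolve_left hc, mul_zero, map_zero, zero_smul]
    have hφk : φ k = φ 1 := by
      have := congrArg (entry F i i) hzρ
      rw [map_smul, map_smul, smul_eq_mul, smul_eq_mul, mul_comm] at this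
      exact (mul_left_cancel₀ hzi this).symm
    have : φ 1 • (r * z) = φ 1 • (entry F i i z • (r * u)) := by
      rw [← mul_smul_comm, hzρ, mul_smul_comm, hrρ k (hφk ▸ hc), hρu, mul_smul_comm,
        smul_comm]
    exact smul_right_injective _ hc this
  -- Summing `hyk` over all degrees gives `r * y = y_ii • (r * u)`, and `y_ii = 0` since `i ≠ j`.
  have hry : r * y = 0 := by
    obtain ⟨t, -, ht⟩ := Γ.exists_finset_sum_proj y
    conv_lhs => rw [← ht, Finset.mul_sum]
    simp only [hyk]
    rw [← Finset.sum_smul, ← map_sum, ht, hyi, zero_smul]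
  have : r * y = e * unit F i j hgt.le * u := by
    have hd : unit F i i le_rfl * u * unit F i j hgt.le = unit F i j hgt.le := by
      rw [unit_mul_mul_unit _ _ le_rfl, hui, one_smul]
    calc r * y = e * (unit F i i le_rfl * (e * u) * unit F i j hgt.le) * u := by
          rw [hr, hy]; simp only [mul_assoc]
      _ = _ := by rw [heu, hd]
  -- On the other hand, this entry equals `e_ii`-th diagonal value of `e` times `u_jj`, both of
  -- which are 1.
  have hij : entry F i j (r * y) = 1 := by
    have h1 : entry F i j (unit F i i le_rfl * (r * y)) = entry F i j (r * y) := by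
      rw [entry_unit_mul, if_pos rfl]
    rw [← h1, this, ← mul_assoc, ← mul_assoc, unit_mul_mul_unit _ _ le_rfl, hi, one_smul, entry_unit_mul,
      if_pos rfl, huj]
  rw [hry, map_zero] at hij
  exact zero_ne_one hij

/-! ### Idempotent local units of degree 1. -/

theorem entry_corner_self {n k : ℕ} (hk : k < n) : entry F k k (corner F n) = 1 := by
  simp only [corner, map_sum, entry_unit, and_self]
  rw [Finset.sum_ite_eq, if_pos (Finset.mem_range.2 hk)]

theorem corner_mul_corner (n m : ℕ) (h : n ≤ m) :
    corner F n * corner F m = corner F n ∧ corner F m * corner F n = corner F n := by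
  have : ∀ i j, m ≤ j → entry F i j (corner F n) = 0 := by
    intro i j hj
    simp only [corner, map_sum, entry_unit]
    refine Finset.sum_eq_zero fun k hk => if_neg ?_
    rw [Finset.mem_range] at hk
    omega
  exact ⟨mul_corner this, corner_mul this⟩

/-- The homogeneous elements of degree `1` which act as an identity on `UT_n` from both sides. -/
structure IsLocalUnit (Γ : GroupGrading F G (UT F)) (n : ℕ) (x : UT F) : Prop where
  mem : x ∈ Γ.component 1
  mul_corner : x * corner F n = corner F n
  corner_mul : corner F n * x = corner F n

/-- Take `N` so large that `corner F N` fixes every homogeneous component `c` of `corner F n`.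
Comparing degrees in `corner F N * c = c` shows that the degree 1 part of `corner F N` already fixes
`c`; similarly on the right. -/
theorem exists_isLocalUnit (Γ : GroupGrading F G (UT F)) (n : ℕ) : ∃ x, IsLocalUnit Γ n x := by
  obtain ⟨s, -, hs⟩ := Γ.exists_finset_sum_proj (corner F n)
  obtain ⟨N, hN⟩ := exists_corner_finset s fun g => Γ.proj g (corner F n)
  have hN := hN N le_rfl
  refine ⟨Γ.proj 1 (corner F N), Γ.proj_mem _ _, ?_, ?_⟩
  · conv_lhs => rw [← hs, Finset.mul_sum]
    refine (Finset.sum_congr rfl fun g hg => ?_).trans hs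
    have := Γ.proj_mul_right (Γ.proj_mem g (corner F n)) 1 (corner F N)
    rw [← this, (hN g hg).1, one_mul, Γ.proj_of_mem (Γ.proj_mem _ _)]
  · conv_lhs => rw [← hs, Finset.sum_mul]
    refine (Finset.sum_congr rfl fun g hg => ?_).trans hs
    have := Γ.proj_mul_left (Γ.proj_mem g (corner F n)) 1 (corner F N)
    rw [← this, (hN g hg).2, mul_one, Γ.proj_of_mem (Γ.proj_mem _ _)]

namespace IsLocalUnit

variable {Γ : GroupGrading F G (UT F)} {n : ℕ} {x y : UT F}

theorem mul_eq (h : IsLocalUnit Γ n x) {a : UT F} (ha : corner F n * a = a) : x * a = a := by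
  rw [← ha, ← mul_assoc, h.mul_corner]

theorem eq_mul (h : IsLocalUnit Γ n x) {a : UT F} (ha : a * corner F n = a) : a * x = a := by
  rw [← ha, mul_assoc, h.corner_mul]

theorem diag (h : IsLocalUnit Γ n x) {k : ℕ} (hk : k < n) : entry F k k x = 1 := by
  have := congrArg (entry F k k) h.mul_corner
  rwa [entry_diag_mul, entry_corner_self hk, mul_one] at this

theorem mul (hx : IsLocalUnit Γ n x) (hy : IsLocalUnit Γ n y) : IsLocalUnit Γ n (x * y) where
  mem := Γ.mul_mem_one hx.mem hy.mem
  mul_corner := by rw [mul_assoc, hy.mul_corner, hx.mul_corner]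
  corner_mul := by rw [← mul_assoc, hx.corner_mul, hy.corner_mul]

theorem add_sub_mul (hx : IsLocalUnit Γ n x) (hy : IsLocalUnit Γ n y) :
    IsLocalUnit Γ n (x + y - x * y) where
  mem := sub_mem (add_mem hx.mem hy.mem) (Γ.mul_mem_one hx.mem hy.mem)
  mul_corner := by
    rw [sub_mul, add_mul, (hx.mul hy).mul_corner, hx.mul_corner, hy.mul_corner, add_sub_cancel_right]
  corner_mul := by
    rw [mul_sub, mul_add, (hx.mul hy).corner_mul, hx.corner_mul, hy.corner_mul, add_sub_cancel_right]

/-- The polynomial `(t² - c t) / (1 - c)` fixes 0 and 1 and kills `c`, so it removes the diagonal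
value `c` without disturbing the good ones. -/
theorem smul_mul_sub (hx : IsLocalUnit Γ n x) {c : F} (hc : c ≠ 1) :
    IsLocalUnit Γ n ((1 - c)⁻¹ • (x * x - c • x)) := by
  have h1 : (1 - c)⁻¹ • (corner F n - c • corner F n) = corner F n := by
    conv_lhs => rw [← one_smul F (corner F n), smul_smul, mul_one, ← sub_smul, smul_smul,
      inv_mul_cancel₀ (sub_ne_zero.2 hc.symm), one_smul]
  refine ⟨Submodule.smul_mem _ _ (sub_mem (hx.mul hx).mem (Submodule.smul_mem _ _ hx.mem)), ?_, ?_⟩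
  · rw [smul_mul_assoc, sub_mul, smul_mul_assoc, (hx.mul hx).mul_corner, hx.mul_corner, h1]
  · rw [mul_smul_comm, mul_sub, mul_smul_comm, (hx.mul hx).corner_mul, hx.corner_mul, h1]

theorem exists_pow (hx : IsLocalUnit Γ n x) (m : ℕ) :
    ∃ z, IsLocalUnit Γ n z ∧ z.val = x.val ^ (m + 1) := by
  induction m with
  | zero => exact ⟨x, hx, by rw [zero_add, pow_one]⟩
  | succ m ih =>
    obtain ⟨z, hz, h⟩ := ih
    exact ⟨z * x, hz.mul hx, by rw [pow_succ, ← h]; rfl⟩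

/-- Since `UT` has no identity, the formula is read in the ambient incidence algebra; iterating `x +
y - x * y` keeps the result in `UT`. -/
theorem exists_one_sub_one_sub_pow (hx : IsLocalUnit Γ n x) (m : ℕ) :
    ∃ z, IsLocalUnit Γ n z ∧ z.val = 1 - (1 - x.val) ^ (m + 1) := by
  induction m with
  | zero => exact ⟨x, hx, by rw [zero_add, pow_one, sub_sub_cancel]⟩
  | succ m ih =>
    obtain ⟨z, hz, h⟩ := ih
    refine ⟨z + x - z * x, hz.add_sub_mul hx, ?_⟩
    have h' : (1 - x.val) ^ (m + 1) = 1 - z.val := by rw [h, sub_sub_cancel]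
    have : (z + x - z * x).val = z.val + x.val - z.val * x.val := rfl
    rw [pow_succ, h', this]
    simp only [sub_mul, mul_sub, one_mul, mul_one]
    abel

end IsLocalUnit

theorem exists_isLocalUnit_diag (Γ : GroupGrading F G (UT F)) (n : ℕ) :
    ∃ x, IsLocalUnit Γ n x ∧ ∀ i, entry F i i x = 0 ∨ entry F i i x = 1 := by
  -- Only positions below `d` may still be bad; each step repairs position `d - 1`.
  suffices H : ∀ d x, IsLocalUnit Γ n x → (∀ i, d ≤ i → entry F i i x = 0 ∨ entry F i i x = 1) →
      ∃ x, IsLocalUnit Γ n x ∧ ∀ i, entry F i i x = 0 ∨ entry F i i x = 1 by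
    obtain ⟨x, hx⟩ := exists_isLocalUnit Γ n
    obtain ⟨d, hd⟩ := exists_support x
    exact H d x hx fun i hi => Or.inl (hd i i hi)
  intro d
  induction d with
  | zero => exact fun x hx h => ⟨x, hx, fun i => h i i.zero_le⟩
  | succ d ih =>
    intro x hx h
    by_cases hd : entry F d d x = 0 ∨ entry F d d x = 1
    · refine ih x hx fun i hi => ?_
      rcases hi.eq_or_lt with rfl | hi
      · exact hd
      · exact h i hi
    · obtain ⟨-, hd1⟩ := not_or.1 hd
      refine ih _ (hx.smul_mul_sub hd1) fun i hi => ?_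
      have hv : entry F i i ((1 - entry F d d x)⁻¹ • (x * x - entry F d d x • x))
          = (1 - entry F d d x)⁻¹ * (entry F i i x * entry F i i x
            - entry F d d x * entry F i i x) := by
        simp only [map_smul, map_sub, entry_diag_mul, smul_eq_mul]
      rw [hv]
      rcases hi.eq_or_lt with rfl | hi
      · simp
      · rcases h i hi with h | h
        · simp [h]
        · right
          rw [h, mul_one, mul_one, inv_mul_cancel₀ (sub_ne_zero.2 (Ne.symm hd1))]

theorem exists_pow_eq_zero {z : UT F} (hz : ∀ i, entry F i i z = 0) : ∃ n, z.val ^ (n + 1) = 0 := by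
  obtain ⟨n, hn⟩ := exists_support z
  have hpow : ∀ m i j, j < i + m → (z.val ^ m) i j = 0 := by
    intro m
    induction m with
    | zero => exact fun i j h => IncidenceAlgebra.apply_eq_zero_of_not_le (by omega) _
    | succ m ih =>
      intro i j h
      rw [pow_succ, IncidenceAlgebra.mul_apply]
      refine Finset.sum_eq_zero fun k hk => ?_
      rcases lt_or_ge k (i + m) with h1 | h1
      · rw [ih i k h1, zero_mul]
      · have : z.val k j = 0 := by
          rcases lt_or_eq_of_le (show j ≤ k by omega) with h2 | rfl
          · exact entry_of_lt h2 z
          · exact hz j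
        rw [this, mul_zero]
  -- The exponent `n + 1` ensures at least one factor `z`, whose columns from `n` on vanish, even
  -- when `n = 0`.
  refine ⟨n, IncidenceAlgebra.ext fun i j _ => ?_⟩
  rw [IncidenceAlgebra.zero_apply]
  rcases lt_or_ge j n with h | h
  · exact hpow _ i j (by omega)
  · rw [pow_succ, IncidenceAlgebra.mul_apply]
    refine Finset.sum_eq_zero fun k _ => ?_
    have : z.val k j = 0 := hn k j h
    rw [this, mul_zero]

/-- With diagonal entries 0 and 1, `x - x * x` is nilpotent, so `1 - (1 - x ^ k) ^ k` is idempotent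
for large `k`; it is again a local unit. -/
theorem exists_idem_isLocalUnit (Γ : GroupGrading F G (UT F)) (n : ℕ) :
    ∃ e, IsLocalUnit Γ n e ∧ e * e = e := by
  obtain ⟨x, hx, hd⟩ := exists_isLocalUnit_diag Γ n
  obtain ⟨m, hm⟩ := exists_pow_eq_zero (z := x - x * x) fun i => by
    rw [map_sub, entry_diag_mul]
    rcases hd i with h | h <;> simp [h]
  obtain ⟨y, hy, hyx⟩ := hx.exists_pow m
  obtain ⟨e, he, hey⟩ := hy.exists_one_sub_one_sub_pow m
  refine ⟨e, he, Subtype.ext ?_⟩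
  have hid := isIdempotentElem_one_sub_one_sub_pow_pow x.val (m + 1) (by
    rw [pow_two]; exact hm)
  rw [← hyx, ← hey] at hid
  exact hid

/-! ### Orthogonal families of primitive idempotents. -/

/-- Orthogonal idempotents of degree `1`, the `i`-th one being primitive at `i`. -/
structure IsFamily (Γ : GroupGrading F G (UT F)) (s : Set ℕ) (η : ℕ → UT F) : Prop where
  mem : ∀ i ∈ s, η i ∈ Γ.component 1
  prim : ∀ i ∈ s, IsPrimitiveAt i (η i)
  orth : ∀ i ∈ s, ∀ j ∈ s, i ≠ j → η i * η j = 0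

namespace IsFamily

variable {Γ : GroupGrading F G (UT F)} {s t : Finset ℕ} {η θ : ℕ → UT F}

theorem mul_sum_of_mem (h : IsFamily Γ s η) {i : ℕ} (hi : i ∈ s) : η i * ∑ j ∈ s, η j = η i := by
  rw [Finset.mul_sum, Finset.sum_eq_single_of_mem i hi, (h.prim i hi).idem]
  exact fun j hj hji => h.orth i hi j hj hji.symm

theorem sum_mul_of_mem (h : IsFamily Γ s η) {i : ℕ} (hi : i ∈ s) :
    (∑ j ∈ s, η j) * η i = η i := by
  rw [Finset.sum_mul, Finset.sum_eq_single_of_mem i hi, (h.prim i hi).idem]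
  exact fun j hj hji => h.orth j hj i hi hji

theorem sum_mem (h : IsFamily Γ s η) : ∑ j ∈ s, η j ∈ Γ.component 1 :=
  Submodule.sum_mem _ fun j hj => h.mem j hj

theorem sum_mul_sum (h : IsFamily Γ s η) : (∑ j ∈ s, η j) * ∑ j ∈ s, η j = ∑ j ∈ s, η j := by
  conv_lhs => rw [Finset.sum_mul]
  exact Finset.sum_congr rfl fun i hi => h.mul_sum_of_mem hi

theorem exists_union (h : IsFamily Γ s η) (h' : IsFamily Γ t θ)
    (h1 : (∑ j ∈ s, η j) * ∑ j ∈ t, θ j = 0) (h2 : (∑ j ∈ t, θ j) * ∑ j ∈ s, η j = 0) :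
    ∃ (r : Finset ℕ) (ζ : ℕ → UT F), s ⊆ r ∧ (∀ i ∈ s, ζ i = η i) ∧ IsFamily Γ r ζ ∧
      ∑ j ∈ r, ζ j = ∑ j ∈ s, η j + ∑ j ∈ t, θ j := by
  have o1 : ∀ i ∈ s, ∀ j ∈ t, η i * θ j = 0 := fun i hi j hj => by
    rw [← h.mul_sum_of_mem hi, ← h'.sum_mul_of_mem hj, mul_assoc, ← mul_assoc (∑ j ∈ s, η j), h1,
      zero_mul, mul_zero]
  have o2 : ∀ i ∈ s, ∀ j ∈ t, θ j * η i = 0 := fun i hi j hj => by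
    rw [← h.sum_mul_of_mem hi, ← h'.mul_sum_of_mem hj, mul_assoc, ← mul_assoc (∑ j ∈ t, θ j), h2,
      zero_mul, mul_zero]
  -- A common index `i` would make the `i`-th diagonal entry of `η i * θ i = 0` equal to 1.
  have hd : ∀ i ∈ t, i ∉ s := fun i ht hs => by
    have := entry_diag_mul (η i) (θ i) i
    rw [o1 i hs i ht, (h.prim i hs).diag_self, (h'.prim i ht).diag_self, map_zero, mul_one] at this
    exact zero_ne_one this
  have e1 : ∀ i ∈ s, (if i ∈ s then η i else θ i) = η i := fun i hi => if_pos hi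
  have e2 : ∀ i ∈ t, (if i ∈ s then η i else θ i) = θ i := fun i hi => if_neg (hd i hi)
  refine ⟨s ∪ t, fun i => if i ∈ s then η i else θ i, Finset.subset_union_left, e1, ⟨?_, ?_, ?_⟩, ?_⟩
  · intro i hi
    rcases Finset.mem_union.1 (Finset.mem_coe.1 hi) with hi | hi
    · simp only [e1 i hi]; exact h.mem i hi
    · simp only [e2 i hi]; exact h'.mem i hi
  · intro i hi
    rcases Finset.mem_union.1 (Finset.mem_coe.1 hi) with hi | hi
    · simp only [e1 i hi]; exact h.prim i hi
    · simp only [e2 i hi]; exact h'.prim i hi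
  · intro i hi j hj hij
    rcases Finset.mem_union.1 (Finset.mem_coe.1 hi) with hi | hi <;>
      rcases Finset.mem_union.1 (Finset.mem_coe.1 hj) with hj | hj
    · simp only [e1 i hi, e1 j hj]; exact h.orth i hi j hj hij
    · simp only [e1 i hi, e2 j hj]; exact o1 i hi j hj
    · simp only [e2 i hi, e1 j hj]; exact o2 j hj i hi
    · simp only [e2 i hi, e2 j hj]; exact h'.orth i hi j hj hij
  · rw [Finset.sum_union (Finset.disjoint_right.2 hd), Finset.sum_congr rfl e1,
      Finset.sum_congr rfl e2]

end IsFamily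

/-- A primitive idempotent is split off at the first nonzero diagonal position, and the remainder is
treated likewise; once its diagonal is zero, the remainder is zero. -/
theorem exists_isFamily_sum_eq (Γ : GroupGrading F G (UT F)) {e : UT F} (he1 : e ∈ Γ.component 1)
    (he : e * e = e) : ∃ (s : Finset ℕ) (η : ℕ → UT F), IsFamily Γ s η ∧ ∑ j ∈ s, η j = e := by
  obtain ⟨N, hN⟩ := exists_support e
  suffices H : ∀ d m e, N ≤ m + d → e ∈ Γ.component 1 → e * e = e →
      (∀ k, N ≤ k → entry F k k e = 0) → (∀ k < m, entry F k k e = 0) →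
      ∃ (s : Finset ℕ) (η : ℕ → UT F), IsFamily Γ s η ∧ ∑ j ∈ s, η j = e from
    H N 0 e (by omega) he1 he (fun k => hN k k) (by simp)
  intro d
  induction d with
  | zero =>
    intro m e hm _ he hN h0
    refine ⟨∅, 0, ⟨by simp, by simp, by simp⟩, ?_⟩
    rw [Finset.sum_empty]
    exact (eq_zero_of_idem he fun k => (le_or_gt N k).elim (hN k) fun h => h0 k (by omega)).symm
  | succ d ih =>
    intro m e hm he1 he hN h0
    rcases entry_diag_of_idem he m with hme | hme
    · refine ih (m + 1) e (by omega) he1 he hN fun k hk => ?_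
      rcases Nat.lt_succ_iff_lt_or_eq.1 hk with hk | rfl
      · exact h0 k hk
      · exact hme
    · obtain ⟨u, hu1, heu, hue, hu⟩ := exists_isPrimitiveAt Γ he1 he hme h0
      have hmN : m < N := by
        by_contra h
        rw [hN m (not_lt.1 h)] at hme
        exact zero_ne_one hme
      have hu' : IsFamily Γ ({m} : Finset ℕ) fun _ => u := by
        refine ⟨fun i _ => hu1, fun i hi => ?_, fun i hi j hj hij => ?_⟩
        · rw [Finset.mem_coe, Finset.mem_singleton] at hi
          exact hi ▸ hu
        · rw [Finset.mem_coe, Finset.mem_singleton] at hi hj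
          exact absurd (hi.trans hj.symm) hij
      obtain ⟨s, η, hη, hs⟩ := ih (m + 1) (e - u) (by omega) (sub_mem he1 hu1)
        (by rw [sub_mul, mul_sub, mul_sub, he, heu, hue, hu.idem, sub_self, sub_zero])
        (fun k hk => by rw [map_sub, hN k hk, hu.diag, if_neg (by omega), sub_zero])
        (fun k hk => by
          rcases Nat.lt_succ_iff_lt_or_eq.1 hk with hk | rfl
          · rw [map_sub, h0 k hk, hu.diag, if_neg (by omega), sub_zero]
          · rw [map_sub, hme, hu.diag_self, sub_self])
      obtain ⟨r, ζ, -, -, hζ, hr⟩ := hu'.exists_union hη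
        (by rw [hs, Finset.sum_singleton, mul_sub, hue, hu.idem, sub_self])
        (by rw [hs, Finset.sum_singleton, sub_mul, heu, hu.idem, sub_self])
      exact ⟨r, ζ, hζ, by rw [hr, hs, Finset.sum_singleton, add_sub_cancel]⟩

theorem IsLocalUnit.mono {Γ : GroupGrading F G (UT F)} {n m : ℕ} {x : UT F}
    (h : IsLocalUnit Γ m x) (hnm : n ≤ m) : IsLocalUnit Γ n x where
  mem := h.mem
  mul_corner := h.mul_eq (corner_mul_corner n m hnm).2
  corner_mul := h.eq_mul (corner_mul_corner n m hnm).1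

/-- An idempotent local unit large enough to fix the present sum `e` is chosen, and its difference
with `e` is decomposed. -/
theorem IsFamily.exists_extension {Γ : GroupGrading F G (UT F)} {s : Finset ℕ} {η : ℕ → UT F}
    (h : IsFamily Γ s η) (n : ℕ) : ∃ (r : Finset ℕ) (ζ : ℕ → UT F), IsFamily Γ r ζ ∧
      s ⊆ r ∧ (∀ i ∈ s, ζ i = η i) ∧ IsLocalUnit Γ n (∑ j ∈ r, ζ j) := by
  set e := ∑ j ∈ s, η j with he
  obtain ⟨m, hm⟩ := exists_corner e
  obtain ⟨x, hx, hxx⟩ := exists_idem_isLocalUnit Γ (max n m)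
  obtain ⟨h1, h2⟩ := hm _ (le_max_right n m)
  have hxe := hx.mul_eq h1
  have hex := hx.eq_mul h2
  have hee : e * e = e := h.sum_mul_sum
  obtain ⟨t, θ, hθ, ht⟩ := exists_isFamily_sum_eq Γ (sub_mem hx.mem h.sum_mem)
    (by rw [← he, sub_mul, mul_sub, mul_sub, hxx, hxe, hex, hee, sub_self, sub_zero])
  obtain ⟨r, ζ, hsr, hηζ, hζ, hr⟩ := h.exists_union hθ
    (by rw [ht, ← he, mul_sub, hex, hee, sub_self]) (by rw [ht, ← he, sub_mul, hxe, hee, sub_self])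
  refine ⟨r, ζ, hζ, hsr, hηζ, ?_⟩
  rw [hr, ht, add_sub_cancel]
  exact hx.mono (le_max_left n m)

theorem IsFamily.mem_of_isLocalUnit {Γ : GroupGrading F G (UT F)} {s : Finset ℕ} {η : ℕ → UT F}
    (h : IsFamily Γ s η) {n k : ℕ} (hn : IsLocalUnit Γ n (∑ j ∈ s, η j)) (hk : k < n) : k ∈ s := by
  have h1 := hn.diag hk
  rw [map_sum] at h1
  obtain ⟨j, hj, hjk⟩ := Finset.exists_ne_zero_of_sum_ne_zero (h1.symm ▸ one_ne_zero)
  rw [(h.prim j hj).diag] at hjk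
  have : k = j := by
    by_contra hne
    exact hjk (if_neg hne)
  exact this ▸ hj

theorem exists_isFamily_univ (Γ : GroupGrading F G (UT F)) : ∃ η : ℕ → UT F,
    IsFamily Γ Set.univ η ∧ ∀ n, ∃ s : Finset ℕ, IsLocalUnit Γ n (∑ j ∈ s, η j) := by
  choose next hnext using fun (p : {p : Finset ℕ × (ℕ → UT F) // IsFamily Γ p.1 p.2}) (n : ℕ) =>
    show ∃ q : {p : Finset ℕ × (ℕ → UT F) // IsFamily Γ p.1 p.2}, p.1.1 ⊆ q.1.1 ∧
        (∀ i ∈ p.1.1, q.1.2 i = p.1.2 i) ∧ IsLocalUnit Γ n (∑ j ∈ q.1.1, q.1.2 j) by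
      obtain ⟨r, ζ, h, h'⟩ := p.2.exists_extension n
      exact ⟨⟨⟨r, ζ⟩, h⟩, h'⟩
  let S : ℕ → {p : Finset ℕ × (ℕ → UT F) // IsFamily Γ p.1 p.2} := fun n =>
    Nat.rec ⟨⟨∅, 0⟩, ⟨by simp, by simp, by simp⟩⟩ (fun n p => next p (n + 1)) n
  have hS : ∀ n, S (n + 1) = next (S n) (n + 1) := fun n => rfl
  have hmono : ∀ m n, m ≤ n → (S m).1.1 ⊆ (S n).1.1 ∧ ∀ i ∈ (S m).1.1, (S n).1.2 i = (S m).1.2 i := by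
    intro m n hmn
    induction n, hmn using Nat.le_induction with
    | base => exact ⟨subset_rfl, fun _ _ => rfl⟩
    | succ n _ ih =>
      rw [hS]
      refine ⟨ih.1.trans (hnext (S n) (n + 1)).1, fun i hi => ?_⟩
      rw [(hnext (S n) (n + 1)).2.1 i (ih.1 hi), ih.2 i hi]
  have hunit : ∀ n, IsLocalUnit Γ (n + 1) (∑ j ∈ (S (n + 1)).1.1, (S (n + 1)).1.2 j) := fun n => by
    rw [hS]; exact (hnext (S n) (n + 1)).2.2
  -- Stage `i + 1` is a local unit for `UT_{i+1}`, the first one containing position `i`; hence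
  -- every index is eventually reached.
  have hself : ∀ i, i ∈ (S (i + 1)).1.1 := fun i =>
    (S (i + 1)).2.mem_of_isLocalUnit (hunit i) i.lt_succ_self
  have hη : ∀ n, ∀ i ∈ (S n).1.1, (S (i + 1)).1.2 i = (S n).1.2 i := by
    intro n i hi
    rcases le_total n (i + 1) with h | h
    · exact (hmono _ _ h).2 i hi
    · exact ((hmono _ _ h).2 i (hself i)).symm
  refine ⟨fun i => (S (i + 1)).1.2 i, ⟨fun i _ => (S (i + 1)).2.mem i (hself i),
    fun i _ => (S (i + 1)).2.prim i (hself i), fun i _ j _ hij => ?_⟩, fun n => ?_⟩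
  · have h1 := (hmono _ _ (le_max_left (i + 1) (j + 1))).1 (hself i)
    have h2 := (hmono _ _ (le_max_right (i + 1) (j + 1))).1 (hself j)
    rw [hη _ i h1, hη _ j h2]
    exact (S (max (i + 1) (j + 1))).2.orth i h1 j h2 hij
  · refine ⟨(S (n + 1)).1.1, ?_⟩
    rw [Finset.sum_congr rfl (hη (n + 1))]
    exact (hunit n).mono n.le_succ

/-! ### Matrix units and coordinates of a complete family. -/

theorem entry_mul_unit_mul (x y : UT F) {i j : ℕ} (h : i ≤ j) (k l : ℕ) :
    entry F k l (x * unit F i j h * y) = entry F k i x * entry F j l y := by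
  rw [entry_mul]
  simp only [entry_mul_unit, ite_mul, zero_mul]
  rw [Finset.sum_ite_eq']
  split_ifs with hj
  · rfl
  · rw [Finset.mem_Icc, not_and_or, not_le, not_le] at hj
    rcases hj with hj | hj
    · rw [entry_of_lt (h.trans_lt hj) x, zero_mul]
    · rw [entry_of_lt hj y, mul_zero]

theorem IsPrimitiveAt.entry_mul {j : ℕ} {e : UT F} (he : IsPrimitiveAt j e) {x y : UT F}
    (hx : x * e = x) (hy : e * y = y) (i k : ℕ) :
    entry F i k (x * y) = entry F i j x * entry F j k y := by
  have : x * y = x * e * unit F j j le_rfl * (e * y) := by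
    conv_lhs => rw [← hx, ← he.mul_unit_mul]
    simp only [mul_assoc]
  rw [this, entry_mul_unit_mul, hx, hy]

namespace IsFamily

variable {Γ : GroupGrading F G (UT F)} {η : ℕ → UT F}

/-- The matrix units attached to a family of primitive idempotents. -/
def matrixUnit (η : ℕ → UT F) (i j : ℕ) (h : i ≤ j) : UT F := η i * unit F i j h * η j

theorem prim' (h : IsFamily Γ Set.univ η) (i : ℕ) : IsPrimitiveAt i (η i) := h.prim i trivial

theorem mem' (h : IsFamily Γ Set.univ η) (i : ℕ) : η i ∈ Γ.component 1 := h.mem i trivial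

theorem mul_eq_ite (h : IsFamily Γ Set.univ η) (i j : ℕ) :
    η i * η j = if i = j then η i else 0 := by
  split_ifs with hij
  · rw [← hij, (h.prim' i).idem]
  · exact h.orth i trivial j trivial hij

theorem entry_matrixUnit (h : IsFamily Γ Set.univ η) {i j : ℕ} (hij : i ≤ j) :
    entry F i j (matrixUnit η i j hij) = 1 := by
  rw [matrixUnit, entry_mul_unit_mul, (h.prim' i).diag_self, (h.prim' j).diag_self, mul_one]

theorem matrixUnit_ne_zero (h : IsFamily Γ Set.univ η) {i j : ℕ} (hij : i ≤ j) :
    matrixUnit η i j hij ≠ 0 := fun h0 => by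
  have := h.entry_matrixUnit hij
  rw [h0, map_zero] at this
  exact zero_ne_one this

theorem mul_matrixUnit (h : IsFamily Γ Set.univ η) {i j : ℕ} (hij : i ≤ j) :
    η i * matrixUnit η i j hij = matrixUnit η i j hij := by
  rw [matrixUnit, ← mul_assoc, ← mul_assoc, (h.prim' i).idem]

theorem matrixUnit_mul (h : IsFamily Γ Set.univ η) {i j : ℕ} (hij : i ≤ j) :
    matrixUnit η i j hij * η j = matrixUnit η i j hij := by
  rw [matrixUnit, mul_assoc, (h.prim' j).idem]

theorem eq_smul_matrixUnit (h : IsFamily Γ Set.univ η) {i j : ℕ} (hij : i ≤ j) {x : UT F}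
    (hx : η i * x = x) (hx' : x * η j = x) : x = entry F i j x • matrixUnit η i j hij := by
  rw [← sub_eq_zero]
  refine (h.prim' i).eq_zero_of_entry (h.prim' j) ?_ ?_ ?_
  · rw [mul_sub, mul_smul_comm, hx, h.mul_matrixUnit]
  · rw [sub_mul, smul_mul_assoc, hx', h.matrixUnit_mul]
  · rw [map_sub, map_smul, h.entry_matrixUnit, smul_eq_mul, mul_one, sub_self]

theorem matrixUnit_mul_matrixUnit (h : IsFamily Γ Set.univ η) {i j k : ℕ} (hij : i ≤ j)
    (hjk : j ≤ k) :
    matrixUnit η i j hij * matrixUnit η j k hjk = matrixUnit η i k (hij.trans hjk) := by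
  rw [h.eq_smul_matrixUnit (hij.trans hjk) (x := matrixUnit η i j hij * matrixUnit η j k hjk)
    (by rw [← mul_assoc, h.mul_matrixUnit]) (by rw [mul_assoc, h.matrixUnit_mul]),
    (h.prim' j).entry_mul (h.matrixUnit_mul hij) (h.mul_matrixUnit hjk), h.entry_matrixUnit,
    h.entry_matrixUnit, mul_one, one_smul]

/-- Multiplication by `η i` and `η j`, of degree 1, commutes with the projections, so every
homogeneous component of the matrix unit lies on its own line; a nonzero one is proportional to it.
-/
theorem exists_degree (h : IsFamily Γ Set.univ η) {i j : ℕ} (hij : i ≤ j) :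
    ∃ g, matrixUnit η i j hij ∈ Γ.component g := by
  obtain ⟨g, hg⟩ := Γ.exists_proj_ne_zero (h.matrixUnit_ne_zero hij)
  have := h.eq_smul_matrixUnit hij (x := Γ.proj g (matrixUnit η i j hij))
    (by rw [← Γ.proj_mul_of_mem_one (h.mem' i), h.mul_matrixUnit])
    (by rw [← Γ.mul_proj_of_mem_one (h.mem' j), h.matrixUnit_mul])
  have hm := Γ.proj_mem g (matrixUnit η i j hij)
  set c := entry F i j (Γ.proj g (matrixUnit η i j hij))
  have hc : c ≠ 0 := fun hc => hg (by rw [this, hc, zero_smul])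
  refine ⟨g, ?_⟩
  rw [this] at hm
  exact (Submodule.smul_mem_iff _ hc).1 hm

theorem exists_degree_map (h : IsFamily Γ Set.univ η) : ∃ γ : ℕ → G, γ 0 = 1 ∧
    ∀ i j (hij : i ≤ j), matrixUnit η i j hij ∈ Γ.component ((γ i)⁻¹ * γ j) := by
  -- The value `γ j` is the degree of the unit at `(0, j)`; the other degrees follow from `(0, i) *
  -- (i, j) = (0, j)`.
  choose γ hγ using fun j => h.exists_degree (Nat.zero_le j)
  have h0 : matrixUnit η 0 0 le_rfl ∈ Γ.component 1 := by
    rw [matrixUnit, (h.prim' 0).mul_unit_mul]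
    exact h.mem' 0
  refine ⟨γ, Γ.eq_of_mem_of_mem (h.matrixUnit_ne_zero le_rfl) (hγ 0) h0, fun i j hij => ?_⟩
  obtain ⟨g, hg⟩ := h.exists_degree hij
  have h1 := Γ.mul_mem (hγ i) hg
  rw [h.matrixUnit_mul_matrixUnit] at h1
  have h2 := Γ.eq_of_mem_of_mem (h.matrixUnit_ne_zero (Nat.zero_le j)) h1 (hγ j)
  rwa [← h2, inv_mul_cancel_left]

theorem exists_sum_mul_eq (h' : ∀ n, ∃ s : Finset ℕ, IsLocalUnit Γ n (∑ j ∈ s, η j)) (a : UT F) :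
    ∃ s : Finset ℕ, (∑ j ∈ s, η j) * a = a ∧ a * (∑ j ∈ s, η j) = a := by
  obtain ⟨n, hn⟩ := exists_corner a
  obtain ⟨s, hs⟩ := h' n
  exact ⟨s, hs.mul_eq (hn n le_rfl).1, hs.eq_mul (hn n le_rfl).2⟩

theorem mul_eq_zero_of_notMem (h : IsFamily Γ Set.univ η) {s : Finset ℕ} {a : UT F}
    (ha : a * (∑ j ∈ s, η j) = a) {j : ℕ} (hj : j ∉ s) : a * η j = 0 := by
  rw [← ha, mul_assoc, Finset.sum_mul, Finset.sum_eq_zero, mul_zero]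
  intro i hi
  rw [h.mul_eq_ite, if_neg]
  rintro rfl
  exact hj hi

/-- The coordinates of an element of `UT` with respect to the matrix units of a family. -/
def coord (h : IsFamily Γ Set.univ η)
    (h' : ∀ n, ∃ s : Finset ℕ, IsLocalUnit Γ n (∑ j ∈ s, η j)) : UT F →ₙₐ[F] UT F where
  toFun a := ⟨⟨fun i j => entry F i j (η i * a * η j), fun _ _ hij =>
    entry_of_lt (not_le.1 hij) _⟩, by
      obtain ⟨s, -, hs⟩ := exists_sum_mul_eq h' a
      refine Set.mem_iUnion.2 ⟨s.sup id + 1, fun i j hij => ?_⟩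
      have hj : j ∈ s := by
        by_contra hj
        refine hij ?_
        change entry F i j (η i * a * η j) = 0
        rw [mul_assoc, h.mul_eq_zero_of_notMem hs hj, mul_zero, map_zero]
      exact Nat.lt_succ_of_le (Finset.le_sup (f := id) hj)⟩
  map_smul' c a := ext_entry fun i j => by
    change entry F i j (η i * (c • a) * η j) = c • entry F i j (η i * a * η j)
    rw [mul_smul_comm, smul_mul_assoc, map_smul]
  map_zero' := ext_entry fun i j => by
    change entry F i j (η i * 0 * η j) = entry F i j 0
    rw [mul_zero, zero_mul]
  map_add' a b := ext_entry fun i j => by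
    change entry F i j (η i * (a + b) * η j)
      = entry F i j (η i * a * η j) + entry F i j (η i * b * η j)
    rw [mul_add, add_mul, map_add]
  map_mul' a b := ext_entry fun i k => by
    change entry F i k (η i * (a * b) * η k)
      = ∑ j ∈ Finset.Icc i k, entry F i j (η i * a * η j) * entry F j k (η j * b * η k)
    obtain ⟨s, -, hs⟩ := exists_sum_mul_eq h' a
    -- A local unit `∑ η j` is inserted between `a` and `b`, and each `η j` is written as its
    -- square.
    have hab : η i * (a * b) * η k = ∑ j ∈ s, (η i * a * η j) * (η j * b * η k) := by
      conv_lhs => rw [← hs]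
      rw [Finset.mul_sum, Finset.sum_mul, Finset.mul_sum, Finset.sum_mul]
      refine Finset.sum_congr rfl fun j _ => ?_
      conv_lhs => rw [← (h.prim' j).idem]
      simp only [mul_assoc]
    rw [hab, map_sum]
    have hj : ∀ j, entry F i k ((η i * a * η j) * (η j * b * η k))
        = entry F i j (η i * a * η j) * entry F j k (η j * b * η k) := fun j =>
      (h.prim' j).entry_mul (by rw [mul_assoc, (h.prim' j).idem])
        (by rw [← mul_assoc, ← mul_assoc, (h.prim' j).idem]) i k
    simp only [hj]
    -- The sums over `s` and over the interval are compared on their union, where all extra terms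
    -- vanish.
    rw [Finset.sum_subset (Finset.subset_union_left (s₂ := Finset.Icc i k)),
      Finset.sum_subset (Finset.subset_union_right (s₁ := s) (s₂ := Finset.Icc i k))]
    · intro j _ hj
      rw [Finset.mem_Icc, not_and_or, not_le, not_le] at hj
      rcases hj with hj | hj
      · rw [entry_of_lt hj, zero_mul]
      · rw [entry_of_lt hj, mul_zero]
    · intro j _ hj
      rw [mul_assoc (η i), h.mul_eq_zero_of_notMem hs hj, mul_zero, map_zero, zero_mul]

theorem entry_coord (h : IsFamily Γ Set.univ η)
    (h' : ∀ n, ∃ s : Finset ℕ, IsLocalUnit Γ n (∑ j ∈ s, η j)) (a : UT F) (i j : ℕ) :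
    entry F i j (h.coord h' a) = entry F i j (η i * a * η j) := rfl

theorem mul_mul_mul_left (h : IsFamily Γ Set.univ η) (i j : ℕ) (a : UT F) :
    η i * (η i * a * η j) = η i * a * η j := by
  rw [← mul_assoc, ← mul_assoc, (h.prim' i).idem]

theorem mul_mul_mul_right (h : IsFamily Γ Set.univ η) (i j : ℕ) (a : UT F) :
    η i * a * η j * η j = η i * a * η j := by
  rw [mul_assoc, (h.prim' j).idem]

theorem coord_injective (h : IsFamily Γ Set.univ η)
    (h' : ∀ n, ∃ s : Finset ℕ, IsLocalUnit Γ n (∑ j ∈ s, η j)) :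
    Function.Injective (h.coord h') := by
  refine (injective_iff_map_eq_zero (h.coord h')).2 fun a ha => ?_
  obtain ⟨s, hs, hs'⟩ := exists_sum_mul_eq h' a
  rw [← hs, ← hs', Finset.mul_sum, Finset.mul_sum]
  refine Finset.sum_eq_zero fun j _ => ?_
  rw [Finset.sum_mul]
  refine Finset.sum_eq_zero fun i _ => ?_
  rw [← mul_assoc]
  refine (h.prim' i).eq_zero_of_entry (h.prim' j) (h.mul_mul_mul_left i j a)
    (h.mul_mul_mul_right i j a) ?_
  rw [← h.entry_coord h', ha, map_zero]

theorem coord_matrixUnit (h : IsFamily Γ Set.univ η)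
    (h' : ∀ n, ∃ s : Finset ℕ, IsLocalUnit Γ n (∑ j ∈ s, η j)) {i j : ℕ} (hij : i ≤ j) :
    h.coord h' (matrixUnit η i j hij) = unit F i j hij := by
  refine ext_entry fun k l => ?_
  rw [entry_coord, entry_unit]
  have : η k * matrixUnit η i j hij * η l = (η k * η i) * unit F i j hij * (η j * η l) := by
    simp only [matrixUnit, mul_assoc]
  rw [this, h.mul_eq_ite, h.mul_eq_ite]
  by_cases hk : k = i
  · by_cases hl : l = j
    · subst hk hl
      rw [if_pos rfl, if_pos rfl, if_pos ⟨rfl, rfl⟩]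
      exact h.entry_matrixUnit hij
    · rw [if_neg (Ne.symm hl), if_neg (not_and_of_not_right _ hl), mul_zero, map_zero]
  · rw [if_neg hk, if_neg (not_and_of_not_left _ hk), zero_mul, zero_mul, map_zero]

theorem coord_surjective (h : IsFamily Γ Set.univ η)
    (h' : ∀ n, ∃ s : Finset ℕ, IsLocalUnit Γ n (∑ j ∈ s, η j)) :
    Function.Surjective (h.coord h') := by
  intro b
  obtain ⟨n, hn⟩ := exists_eq_sum b
  refine ⟨∑ i ∈ Finset.range n, ∑ j ∈ Finset.range n,
    if hij : i ≤ j then entry F i j b • matrixUnit η i j hij else 0, ?_⟩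
  conv_rhs => rw [hn]
  simp only [map_sum]
  refine Finset.sum_congr rfl fun i _ => Finset.sum_congr rfl fun j _ => ?_
  split_ifs with hij
  · rw [map_smul, coord_matrixUnit]
  · exact map_zero _

theorem isomorphic_elementaryGrading (h : IsFamily Γ Set.univ η)
    (h' : ∀ n, ∃ s : Finset ℕ, IsLocalUnit Γ n (∑ j ∈ s, η j)) {γ : ℕ → G}
    (hγ : ∀ i j (hij : i ≤ j), matrixUnit η i j hij ∈ Γ.component ((γ i)⁻¹ * γ j)) :
    Γ.Isomorphic (elementaryGrading F γ) := by
  refine ⟨h.coord h', ⟨h.coord_injective h', h.coord_surjective h'⟩, fun g a ha => ?_⟩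
  refine mem_elementaryComponent_iff.2 fun i j hne => ?_
  rw [entry_coord] at hne
  have hij : i ≤ j := by
    by_contra hij
    exact hne (entry_of_lt (not_le.1 hij) _)
  have hx := h.eq_smul_matrixUnit hij (h.mul_mul_mul_left i j a) (h.mul_mul_mul_right i j a)
  have hm : η i * a * η j ∈ Γ.component g := by
    have := Γ.mul_mem (Γ.mul_mem (h.mem' i) ha) (h.mem' j)
    rwa [one_mul, mul_one] at this
  rw [hx] at hm
  exact Γ.eq_of_mem_of_mem (h.matrixUnit_ne_zero hij) (hγ i j hij)
    ((Submodule.smul_mem_iff _ hne).1 hm)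

end IsFamily

theorem exists_isomorphic_elementaryGrading (Γ : GroupGrading F G (UT F)) :
    ∃ γ : ℕ → G, γ 0 = 1 ∧ Γ.Isomorphic (elementaryGrading F γ) := by
  obtain ⟨η, h, h'⟩ := exists_isFamily_univ Γ
  obtain ⟨γ, hγ0, hγ⟩ := h.exists_degree_map
  exact ⟨γ, hγ0, h.isomorphic_elementaryGrading h' hγ⟩

/-! ### Automorphisms of `UT` and uniqueness of the map. -/

theorem unit_mul_unit {i j k : ℕ} (hij : i ≤ j) (hjk : j ≤ k) :
    unit F i j hij * unit F j k hjk = unit F i k (hij.trans hjk) := by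
  refine ext_entry fun m n => ?_
  rw [entry_mul_unit, entry_unit, entry_unit]
  by_cases hm : m = i <;> by_cases hn : n = k <;> simp [hm, hn]

theorem unit_mul_unit_of_ne {i j k l : ℕ} (hij : i ≤ j) (hkl : k ≤ l) (hjk : j ≠ k) :
    unit F i j hij * unit F k l hkl = 0 := by
  refine ext_entry fun m n => ?_
  rw [entry_mul_unit, entry_unit, if_neg (c := _ ∧ _) fun h => hjk h.2.symm, ite_self, map_zero]

theorem unit_ne_zero {i j : ℕ} (hij : i ≤ j) : unit F i j hij ≠ 0 := fun h => by
  have := entry_unit (F := F) i j hij i j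
  rw [h, map_zero, if_pos ⟨rfl, rfl⟩] at this
  exact zero_ne_one this

theorem map_unit_ne_zero {f : UT F →ₙₐ[F] UT F} (hf : Function.Bijective f)
    {i j : ℕ} (hij : i ≤ j) : f (unit F i j hij) ≠ 0 := fun h =>
  unit_ne_zero (F := F) hij (hf.1 (by rw [h, map_zero]))

/-- The image `u` of `e_ii` satisfies `u * UT * u = F u`. With two nonzero diagonal positions `p`
and `q`, the product `u * e_pp * u` would have diagonal entries 1 and 0 there, so it could not be a
multiple of `u`. -/
theorem exists_isPrimitiveAt_map_unit {f : UT F →ₙₐ[F] UT F} (hf : Function.Bijective f)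
    (i : ℕ) : ∃ p, IsPrimitiveAt p (f (unit F i i le_rfl)) := by
  set u := f (unit F i i le_rfl) with hu
  have huu : u * u = u := by rw [hu, ← map_mul, unit_mul_unit]
  obtain ⟨p, hp⟩ : ∃ p, entry F p p u ≠ 0 := by
    by_contra! h
    exact map_unit_ne_zero hf le_rfl (eq_zero_of_idem huu h)
  have hp := (entry_diag_of_idem huu p).resolve_left hp
  refine ⟨p, huu, fun q => ?_⟩
  split_ifs with hqp
  · rw [hqp, hp]
  refine (entry_diag_of_idem huu q).resolve_right fun hq => ?_
  obtain ⟨z, hz⟩ := hf.2 (unit F p p le_rfl)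
  have hy : u * unit F p p le_rfl * u = entry F i i z • u := by
    rw [← hz, hu, ← map_mul, ← map_mul, unit_mul_mul_unit _ _ le_rfl, map_smul]
  have h1 := congrArg (entry F p p) hy
  have h2 := congrArg (entry F q q) hy
  rw [map_smul, entry_diag_mul, entry_diag_mul, entry_unit, hp, if_pos ⟨rfl, rfl⟩] at h1
  rw [map_smul, entry_diag_mul, entry_diag_mul, entry_unit, hq, if_neg fun h => hqp h.1] at h2
  simp only [mul_one, mul_zero, smul_eq_mul] at h1 h2
  exact one_ne_zero (h1.trans h2.symm)

/-- The induced map `τ` on indices is weakly increasing as `f e_ij ≠ 0`, injective by orthogonality,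
and surjective because a missed diagonal position would vanish on the whole image of `f`. A strictly
increasing surjection of `ℕ` is the identity. -/
theorem isPrimitiveAt_map_unit {f : UT F →ₙₐ[F] UT F} (hf : Function.Bijective f)
    (i : ℕ) : IsPrimitiveAt i (f (unit F i i le_rfl)) := by
  choose τ hτ using exists_isPrimitiveAt_map_unit hf
  have hmono : StrictMono τ := by
    intro i j hij
    refine lt_of_le_of_ne ((hτ i).le_of_ne_zero (hτ j) ?_ ?_ (map_unit_ne_zero hf hij.le)) ?_
    · rw [← map_mul, unit_mul_unit]
    · rw [← map_mul, unit_mul_unit]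
    · intro h
      have h0 : f (unit F i i le_rfl) * f (unit F j j le_rfl) = 0 := by
        rw [← map_mul, unit_mul_unit_of_ne _ _ hij.ne, map_zero]
      have := congrArg (entry F (τ i) (τ i)) h0
      rw [entry_diag_mul, (hτ i).diag_self, h, (hτ j).diag_self, mul_one, map_zero] at this
      exact one_ne_zero this
  have hsurj : Function.Surjective τ := by
    intro p
    by_contra! hp
    have h0 : ∀ i j (hij : i ≤ j), entry F p p (f (unit F i j hij)) = 0 := by
      intro i j hij
      rw [← unit_mul_unit le_rfl hij, map_mul, entry_diag_mul, (hτ i).diag,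
        if_neg fun h => hp i h.symm, zero_mul]
    obtain ⟨a, ha⟩ := hf.2 (unit F p p le_rfl)
    have h1 : entry F p p (f a) = 1 := by rw [ha, entry_unit, if_pos ⟨rfl, rfl⟩]
    obtain ⟨n, hn⟩ := exists_eq_sum a
    rw [hn, map_sum, map_sum, Finset.sum_eq_zero] at h1
    · exact zero_ne_one h1
    intro i _
    rw [map_sum, map_sum]
    refine Finset.sum_eq_zero fun j _ => ?_
    split_ifs with hij
    · rw [map_smul, map_smul, h0, smul_zero]
    · rw [map_zero, map_zero]
  have hid : τ = id := (hmono.range_inj strictMono_id).1 (by rw [hsurj.range_eq, Set.range_id])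
  have := hτ i
  rwa [hid] at this

theorem eq_of_isomorphic {γ γ' : ℕ → G} (h0 : γ 0 = 1) (h0' : γ' 0 = 1)
    (h : (elementaryGrading F γ).Isomorphic (elementaryGrading F γ')) : γ = γ' := by
  obtain ⟨f, hf, hfγ⟩ := h
  funext j
  have hmem : unit F 0 j j.zero_le ∈ (elementaryGrading F γ).component (γ j) :=
    Submodule.subset_span ⟨0, j, j.zero_le, by rw [h0, inv_one, one_mul], rfl⟩
  have := mem_elementaryComponent_iff.1 (hfγ _ _ hmem) 0 j fun hz =>
    map_unit_ne_zero hf j.zero_le ((isPrimitiveAt_map_unit hf 0).eq_zero_of_entry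
      (isPrimitiveAt_map_unit hf j) (by rw [← map_mul, unit_mul_unit])
      (by rw [← map_mul, unit_mul_unit]) hz)
  rw [h0', inv_one, one_mul] at this
  exact this.symm

end InfUT

/-- The elementary gradings on `UT` are parametrised by the maps `γ : ℕ → G` sending the first index
to `1`: every `G`-grading on `UT` is isomorphic to some `Γ(γ)`, and `Γ(γ) ≅ Γ(γ')` iff `γ = γ'`. -/
theorem mainTheorem3 (F : Type*) [Field F] (G : Type*) [Group G] :
    (∀ Γ : GroupGrading F G (UT F), ∃ γ : ℕ → G, γ 0 = 1 ∧
      Γ.Isomorphic (elementaryGrading F γ)) ∧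
    (∀ γ γ' : ℕ → G, γ 0 = 1 → γ' 0 = 1 →
      ((elementaryGrading F γ).Isomorphic (elementaryGrading F γ') ↔ γ = γ')) := by
  refine ⟨InfUT.exists_isomorphic_elementaryGrading, fun γ γ' h h' =>
    ⟨InfUT.eq_of_isomorphic h h', ?_⟩⟩
  rintro rfl
  exact ⟨NonUnitalAlgHom.id F (UT F), Function.bijective_id, fun g a ha => ha⟩
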